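/- Let $T>0$, let $B\in\mathbb{R}^{n\times m}$ and $C\in\mathbb{R}^{r\times n}$, and let $\|\cdot\|$ denote the spectral norm of a matrix. For a tuple $\mathcal{S}=(A,\Gamma,R,Q)$ with $A\in\mathbb{R}^{n\times n}$ and symmetric positive definite $\Gamma\in\mathbb{R}^{n\times n}$, $R\in\mathbb{R}^{m\times m}$, $Q\in\mathbb{R}^{r\times r}$, the filter Riccati equation with data $\mathcal{S}$ is $$\dot\Pi(t)=A\Pi(t)+\Pi(t)A^\top-\Pi(t)C^\top Q^{-1}C\,\Pi(t)+BRB^\top,\quad t\in(0,T),\qquad \Pi(0)=\Gamma .$$ Let $\mathcal{S}_*=(A_*,\Gamma_*,R_*,Q_*)$ and $\mathcal{S}_{\bar\sigma}=(A_{\bar\sigma},\Gamma_{\bar\sigma},R_{\bar\sigma},Q_{\bar\sigma})$ be two such tuples and let $\Pi_*,\Pi_{\bar\sigma}\in C([0,T];\mathbb{R}^{n\times n})$ be the solutions of the filter Riccati equations with data $\mathcal{S}_*$ and $\mathcal{S}_{\bar\sigma}$, respectively. Then there is a constant $c_\Pi>0$ such that $$\sup_{t\in[0,T]}\|\Pi_*(t)-\Pi_{\bar\sigma}(t)\|\le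 c_\Pi\,\|\mathcal{S}_*-\mathcal{S}_{\bar\sigma}\|_1 ,$$ where $$\|\mathcal{S}_*-\mathcal{S}_{\bar\sigma}\|_1=\|A_*-A_{\bar\sigma}\|+\|\Gamma_*-\Gamma_{\bar\sigma}\|+\|R_*-R_{\bar\sigma}\|+\|Q_*-Q_{\bar\sigma}\| .$$ The constant $c_\Pi$ depends only on $T$ and on an upper bound $M$ for $\|B\|$, $\|C\|$, $\|Q_*^{-1}\|$, $\|Q_{\bar\sigma}^{-1}\|$ and for the sums $\|A\|+\|\Gamma\|+\|R\|+\|Q\|$ of the norms of the entries of $\mathcal{S}_*$ and of $\mathcal{S}_{\bar\sigma}$; apart from this it does not depend on the two tuples, on $B$, $C$ or on the dimensions. -/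

import Mathlib

-- The norm `‖M‖` of a real matrix is the spectral norm, i.e. the operator norm that is induced
-- by the Euclidean vector norms.
open scoped Matrix Matrix.Norms.L2Operator

namespace KalmanRiccati

/-- A data tuple `𝒮 = (A, Γ, R, Q)` of a system matrix and three matrices of the sizes of the
covariances of the initial value, of the dynamics noise and of the measurement noise. -/
@[ext]
structure Data (n m r : ℕ) where
  /-- system matrix -/
  A : Matrix (Fin n) (Fin n) ℝ
  /-- covariance of the initial value -/
  Γ : Matrix (Fin n) (Fin n) ℝ
  /-- covariance of the noise in the dynamics -/
  R : Matrix (Fin m) (Fin m) ℝ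
  /-- covariance of the noise in the measurement -/
  Q : Matrix (Fin r) (Fin r) ℝ

namespace Data

variable {n m r : ℕ}

/-- Differences of data tuples are taken componentwise. -/
instance : Sub (Data n m r) :=
  ⟨fun S S' => ⟨S.A - S'.A, S.Γ - S'.Γ, S.R - S'.R, S.Q - S'.Q⟩⟩

/-- `‖𝒮‖₁ = ‖A‖ + ‖Γ‖ + ‖R‖ + ‖Q‖`. -/
noncomputable def norm₁ (S : Data n m r) : ℝ :=
  ‖S.A‖ + ‖S.Γ‖ + ‖S.R‖ + ‖S.Q‖

/-- The covariance matrices are symmetric and positive definite. -/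
def IsAdmissible (S : Data n m r) : Prop :=
  S.Γ.PosDef ∧ S.R.PosDef ∧ S.Q.PosDef

end Data

/-- `P ∈ C([0,T]; ℝ^{n×n})` is a solution of the filter Riccati equation
`Ṗ = A P + P Aᵀ - P Cᵀ Q⁻¹ C P + B R Bᵀ` on `(0,T)`, `P(0) = Γ`.
(`Set.IccExtend` only turns `P` into a function on `ℝ`; inside the open interval the derivative
does not depend on the extension.) -/
def IsRiccatiSolution {n m r : ℕ} {T : ℝ} (hT : 0 < T)
    (B : Matrix (Fin n) (Fin m) ℝ) (C : Matrix (Fin r) (Fin n) ℝ) (S : Data n m r)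
    (P : C(Set.Icc (0 : ℝ) T, Matrix (Fin n) (Fin n) ℝ)) : Prop :=
  P ⟨0, Set.left_mem_Icc.mpr hT.le⟩ = S.Γ ∧
  ∀ t : Set.Icc (0 : ℝ) T, (t : ℝ) ∈ Set.Ioo 0 T →
    HasDerivAt (Set.IccExtend hT.le P)
      (S.A * P t + P t * S.Aᵀ - P t * Cᵀ * S.Q⁻¹ * C * P t + B * S.R * Bᵀ) (t : ℝ)

end KalmanRiccati

/-! Once both solutions are bounded by a constant `k` depending only on `M` and `T`, their
difference satisfies a linear differential inequality, and Grönwall (`IsRiccatiCurve.norm_sub_le`)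
gives the estimate. The point is the bound `IsRiccatiCurve.norm_le`: the field is quadratic, so
norms alone give no control up to time `T`. Instead `P` is trapped between scalar multiples of the
identity. At the first time an exponential barrier is touched, the touching vector is an eigenvector
of `P`, so the field reduces to scalars there (`quadraticForm_riccatiField_of_mulVec_eq`); with `G`
and `H` semidefinite, a fast enough exponential contradicts the touching
(`quadraticForm_pos_of_deriv_pos_on_ker`). Symmetry of `P`, needed for this, comes from uniqueness.
-/

namespace KalmanRiccati

open Set Filter Topology

/-! ### Quadratic forms and the first-contact argument -/

section QuadraticForm

variable {n m : ℕ}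

lemma norm_transpose_eq (A : Matrix (Fin n) (Fin m) ℝ) : ‖Aᵀ‖ = ‖A‖ := by
  rw [← Matrix.conjTranspose_eq_transpose_of_trivial, Matrix.l2_opNorm_conjTranspose]

lemma dotProduct_self_eq_norm_sq (x : Fin n → ℝ) : x ⬝ᵥ x = ‖WithLp.toLp 2 x‖ ^ 2 := by
  rw [EuclideanSpace.norm_sq_eq]
  simp [dotProduct, sq]

lemma abs_quadraticForm_le (A : Matrix (Fin n) (Fin n) ℝ) (x : Fin n → ℝ) :
    |x ⬝ᵥ A *ᵥ x| ≤ ‖A‖ * (x ⬝ᵥ x) := by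
  have h1 := abs_real_inner_le_norm (WithLp.toLp 2 x) (WithLp.toLp 2 (A *ᵥ x))
  have h2 : ‖WithLp.toLp 2 (A *ᵥ x)‖ ≤ ‖A‖ * ‖WithLp.toLp 2 x‖ :=
    Matrix.l2_opNorm_mulVec A (WithLp.toLp 2 x)
  have h4 : inner ℝ (WithLp.toLp 2 x) (WithLp.toLp 2 (A *ᵥ x)) = x ⬝ᵥ A *ᵥ x := by
    simp [EuclideanSpace.inner_toLp_toLp, dotProduct_comm]
  rw [h4] at h1
  rw [dotProduct_self_eq_norm_sq]
  calc _ ≤ _ := h1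
    _ ≤ ‖WithLp.toLp 2 x‖ * (‖A‖ * ‖WithLp.toLp 2 x‖) := by gcongr
    _ = _ := by ring

/-- The spectral norm of a symmetric matrix is controlled by its quadratic form. -/
lemma norm_le_of_abs_quadraticForm_le {A : Matrix (Fin n) (Fin n) ℝ} (hA : Aᵀ = A) {c : ℝ}
    (hc : 0 ≤ c) (h : ∀ x : Fin n → ℝ, |x ⬝ᵥ A *ᵥ x| ≤ c * (x ⬝ᵥ x)) : ‖A‖ ≤ c := by
  rw [Matrix.cstar_norm_def, ContinuousLinearMap.norm_eq_iSup_rayleighQuotient]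
  · refine ciSup_le fun x => ?_
    have hx := h x.ofLp
    rw [dotProduct_self_eq_norm_sq] at hx
    have h4 : (Matrix.toEuclideanCLM (n := Fin n) (𝕜 := ℝ) A).reApplyInnerSelf x
        = x.ofLp ⬝ᵥ A *ᵥ x.ofLp := by
      rw [ContinuousLinearMap.reApplyInnerSelf_apply, real_inner_comm, Matrix.inner_toEuclideanCLM]
      simp
    rw [ContinuousLinearMap.rayleighQuotient, h4, abs_div, abs_of_nonneg (sq_nonneg ‖x‖)]
    exact div_le_of_le_mul₀ (sq_nonneg _) hc hx
  · intro x y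
    have h1 := Matrix.inner_toEuclideanCLM A y x
    have h2 := Matrix.inner_toEuclideanCLM A x y
    change inner ℝ (Matrix.toEuclideanCLM (n := Fin n) (𝕜 := ℝ) A x) y
      = inner ℝ x (Matrix.toEuclideanCLM (n := Fin n) (𝕜 := ℝ) A y)
    rw [real_inner_comm, h1, h2, dotProduct_comm, Matrix.dotProduct_mulVec,
      ← Matrix.mulVec_transpose, hA, dotProduct_comm, dotProduct_comm]

lemma quadraticForm_nonneg_of_unit {A : Matrix (Fin n) (Fin n) ℝ}
    (h : ∀ x, x ⬝ᵥ x = 1 → 0 ≤ x ⬝ᵥ A *ᵥ x) (x : Fin n → ℝ) : 0 ≤ x ⬝ᵥ A *ᵥ x := by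
  by_cases hx : x = 0
  · simp [hx]
  have hpos : 0 < ‖WithLp.toLp 2 x‖ := by simpa using hx
  have hunit := h (‖WithLp.toLp 2 x‖⁻¹ • x) (by
    rw [smul_dotProduct, dotProduct_smul, smul_eq_mul, smul_eq_mul, dotProduct_self_eq_norm_sq]
    field_simp)
  rw [Matrix.mulVec_smul, smul_dotProduct, dotProduct_smul, smul_eq_mul, smul_eq_mul] at hunit
  have hinv := inv_pos.2 hpos
  exact nonneg_of_mul_nonneg_right (nonneg_of_mul_nonneg_right hunit hinv) hinv

lemma abs_quadraticForm_le_of_unit {A : Matrix (Fin n) (Fin n) ℝ} {c : ℝ}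
    (h : ∀ x, x ⬝ᵥ x = 1 → |x ⬝ᵥ A *ᵥ x| ≤ c) (x : Fin n → ℝ) :
    |x ⬝ᵥ A *ᵥ x| ≤ c * (x ⬝ᵥ x) := by
  have h1 := quadraticForm_nonneg_of_unit (A := c • 1 - A) (fun y hy => by
    simp only [Matrix.sub_mulVec, Matrix.smul_mulVec, Matrix.one_mulVec, dotProduct_sub,
      dotProduct_smul, hy, smul_eq_mul, mul_one]
    linarith [(abs_le.1 (h y hy)).2]) x
  have h2 := quadraticForm_nonneg_of_unit (A := c • 1 + A) (fun y hy => by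
    simp only [Matrix.add_mulVec, Matrix.smul_mulVec, Matrix.one_mulVec, dotProduct_add,
      dotProduct_smul, hy, smul_eq_mul, mul_one]
    linarith [(abs_le.1 (h y hy)).1]) x
  simp only [Matrix.sub_mulVec, Matrix.add_mulVec, Matrix.smul_mulVec, Matrix.one_mulVec,
    dotProduct_sub, dotProduct_add, dotProduct_smul, smul_eq_mul] at h1 h2
  exact abs_le.2 ⟨by linarith, by linarith⟩

/-- `Fin n → ℝ` carries the sup norm, so this is not a metric sphere; closedness and boundedness are
checked directly. -/
lemma isCompact_dotProduct_sphere : IsCompact {x : Fin n → ℝ | x ⬝ᵥ x = 1} := by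
  refine Metric.isCompact_of_isClosed_isBounded
    (isClosed_eq (continuous_id.dotProduct continuous_id) continuous_const) ?_
  refine (Metric.isBounded_closedBall (x := (0 : Fin n → ℝ)) (r := 1)).subset fun x hx => ?_
  rw [mem_closedBall_zero_iff, pi_norm_le_iff_of_nonneg zero_le_one]
  intro i
  rw [Real.norm_eq_abs, ← sq_le_one_iff_abs_le_one]
  have h : x i * x i ≤ ∑ j, x j * x j :=
    Finset.single_le_sum (f := fun j => x j * x j) (fun j _ => mul_self_nonneg _)
      (Finset.mem_univ i)
  have hx' : ∑ j, x j * x j = 1 := hx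
  nlinarith

/-- The quadratic form of a matrix at a fixed vector, as a continuous linear functional of the
matrix. -/
noncomputable def quadraticFormCLM (x : Fin n → ℝ) : Matrix (Fin n) (Fin n) ℝ →L[ℝ] ℝ :=
  LinearMap.toContinuousLinearMap
    { toFun := fun A => x ⬝ᵥ A *ᵥ x
      map_add' := fun A A' => by simp [Matrix.add_mulVec]
      map_smul' := fun c A => by simp [Matrix.smul_mulVec] }

@[simp]
lemma quadraticFormCLM_apply (x : Fin n → ℝ) (A : Matrix (Fin n) (Fin n) ℝ) :
    quadraticFormCLM x A = x ⬝ᵥ A *ᵥ x := rfl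

/-- A symmetric matrix curve that starts positive definite stays so if its quadratic form
increases strictly in every direction of the kernel at times of semidefiniteness. -/
lemma quadraticForm_pos_of_deriv_pos_on_ker {T : ℝ} {W W' : ℝ → Matrix (Fin n) (Fin n) ℝ}
    (hc : ContinuousOn W (Icc 0 T)) (hsymm : ∀ t ∈ Icc 0 T, (W t)ᵀ = W t)
    (h0 : ∀ x, x ⬝ᵥ x = 1 → 0 < x ⬝ᵥ W 0 *ᵥ x)
    (hd : ∀ t ∈ Ioo 0 T, HasDerivAt W (W' t) t)
    (hker : ∀ t ∈ Ioo 0 T, ∀ x, x ⬝ᵥ x = 1 → W t *ᵥ x = 0 → 0 < x ⬝ᵥ W' t *ᵥ x) :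
    ∀ t ∈ Ico 0 T, ∀ x, x ⬝ᵥ x = 1 → 0 < x ⬝ᵥ W t *ᵥ x := by
  intro s hs y hy
  by_contra hneg
  have hsub : Icc 0 s ⊆ Icc 0 T := Icc_subset_Icc_right hs.2.le
  set K : Set (ℝ × (Fin n → ℝ)) := Icc 0 s ×ˢ {x | x ⬝ᵥ x = 1} with hK
  have hKc : IsCompact K := isCompact_Icc.prod isCompact_dotProduct_sphere
  have hform : ContinuousOn (fun p : ℝ × (Fin n → ℝ) => p.2 ⬝ᵥ W p.1 *ᵥ p.2) K := by
    rw [continuousOn_iff_continuous_domRestrict]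
    have h1 : Continuous fun p : K => W p.1.1 :=
      continuousOn_iff_continuous_domRestrict.1
        ((hc.mono hsub).comp continuous_fst.continuousOn fun p hp => hp.1)
    have h2 : Continuous fun p : K => p.1.2 := continuous_snd.comp continuous_subtype_val
    exact h2.dotProduct (h1.matrix_mulVec h2)
  have hZc : IsCompact (K ∩ (fun p : ℝ × (Fin n → ℝ) => p.2 ⬝ᵥ W p.1 *ᵥ p.2) ⁻¹' Iic 0) :=
    hKc.of_isClosed_subset (hform.preimage_isClosed_of_isClosed hKc.isClosed isClosed_Iic)
      inter_subset_left
  -- First contact: the earliest time `t` at which some unit vector has a nonpositive value.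
  obtain ⟨⟨t, x⟩, ⟨⟨⟨ht0, hts⟩, hx⟩, hle⟩, hmin⟩ :=
    hZc.exists_isMinOn ⟨(s, y), ⟨⟨hs.1, le_rfl⟩, hy⟩, not_lt.1 hneg⟩ continuous_fst.continuousOn
  simp only [mem_ofPred_eq, mem_preimage, mem_Iic] at ht0 hts hx hle
  have hbefore : ∀ τ ∈ Ico 0 t, ∀ z, z ⬝ᵥ z = 1 → 0 < z ⬝ᵥ W τ *ᵥ z := by
    intro τ hτ z hz
    by_contra hcon
    have := hmin (show (τ, z) ∈ _ from ⟨⟨⟨hτ.1, hτ.2.le.trans hts⟩, hz⟩, not_lt.1 hcon⟩)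
    exact absurd hτ.2 (not_lt.2 this)
  have htpos : 0 < t := by
    rcases ht0.eq_or_lt with h | h
    · subst h; exact absurd (h0 x hx) (not_lt.2 hle)
    · exact h
  have htT : t ∈ Ioo 0 T := ⟨htpos, hts.trans_lt hs.2⟩
  have hWc : Tendsto W (𝓝[<] t) (𝓝 (W t)) :=
    (hd t htT).continuousAt.tendsto.mono_left nhdsWithin_le_nhds
  have hIoo : Ioo 0 t ∈ 𝓝[<] t := Ioo_mem_nhdsLT htpos
  have hunit : ∀ z, z ⬝ᵥ z = 1 → 0 ≤ z ⬝ᵥ W t *ᵥ z := by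
    intro z hz
    refine ge_of_tendsto (((quadraticFormCLM z).continuous.tendsto _).comp hWc) ?_
    filter_upwards [hIoo] with τ hτ
    exact (hbefore τ ⟨hτ.1.le, hτ.2⟩ z hz).le
  have hpsd : (W t).PosSemidef := by
    refine .of_dotProduct_mulVec_nonneg
      (by rw [Matrix.IsHermitian, Matrix.conjTranspose_eq_transpose_of_trivial]
          exact hsymm t ⟨ht0, htT.2.le⟩) fun z => ?_
    rw [star_trivial]
    exact quadraticForm_nonneg_of_unit hunit z
  have hzero : x ⬝ᵥ W t *ᵥ x = 0 := le_antisymm hle (hunit x hx)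
  -- For a semidefinite matrix, a zero of the quadratic form lies in the kernel.
  have hker0 : W t *ᵥ x = 0 := (hpsd.dotProduct_mulVec_zero_iff x).1 (by simpa using hzero)
  have hpos := hker t htT x hx hker0
  have hder : HasDerivAt (fun τ => x ⬝ᵥ W τ *ᵥ x) (x ⬝ᵥ W' t *ᵥ x) t :=
    (quadraticFormCLM x).hasFDerivAt.comp_hasDerivAt t (hd t htT)
  have hslope := (hasDerivAt_iff_tendsto_slope_left_right.1 hder).1
  -- The form at `x` is positive before `t` and vanishes at `t`, so its left slopes are nonpositive.
  have : x ⬝ᵥ W' t *ᵥ x ≤ 0 := by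
    refine le_of_tendsto hslope ?_
    filter_upwards [hIoo] with τ hτ
    rw [slope_def_field, hzero, sub_zero]
    exact div_nonpos_of_nonneg_of_nonpos (hbefore τ ⟨hτ.1.le, hτ.2⟩ x hx).le
      (sub_nonpos.2 hτ.2.le)
  linarith

end QuadraticForm

/-! ### Matrix Riccati equations: stability, symmetry and a priori bounds -/

section RiccatiCurve

variable {n : ℕ}

/-- The right-hand side `A P + P Aᵀ - P G P + H` of a matrix Riccati equation. -/
def riccatiField (A G H P : Matrix (Fin n) (Fin n) ℝ) : Matrix (Fin n) (Fin n) ℝ :=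
  A * P + P * Aᵀ - P * G * P + H

/-- `P` is continuous on `[0,T]` and solves `Ṗ = A P + P Aᵀ - P G P + H` on `(0,T)`. -/
structure IsRiccatiCurve (T : ℝ) (A G H : Matrix (Fin n) (Fin n) ℝ)
    (P : ℝ → Matrix (Fin n) (Fin n) ℝ) : Prop where
  continuousOn : ContinuousOn P (Icc 0 T)
  hasDerivAt : ∀ t ∈ Ioo 0 T, HasDerivAt P (riccatiField A G H (P t)) t

lemma continuous_riccatiField (A G H : Matrix (Fin n) (Fin n) ℝ) :
    Continuous (riccatiField A G H) := by
  unfold riccatiField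
  fun_prop

/-- Telescoping: every summand carries exactly one difference, of the solutions or of the data. -/
lemma riccatiField_sub (A₁ A₂ G₁ G₂ H₁ H₂ P₁ P₂ : Matrix (Fin n) (Fin n) ℝ) :
    riccatiField A₁ G₁ H₁ P₁ - riccatiField A₂ G₂ H₂ P₂ =
      (A₁ - A₂) * P₁ + A₂ * (P₁ - P₂) + P₁ * (A₁ - A₂)ᵀ + (P₁ - P₂) * A₂ᵀ
        - (P₁ - P₂) * G₁ * P₁ - P₂ * (G₁ - G₂) * P₁ - P₂ * G₂ * (P₁ - P₂) + (H₁ - H₂) := by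
  rw [Matrix.transpose_sub]
  unfold riccatiField
  noncomm_ring

lemma norm_riccatiField_sub_le {A₁ A₂ G₁ G₂ H₁ H₂ P₁ P₂ : Matrix (Fin n) (Fin n) ℝ} {k a g : ℝ}
    (hP₁ : ‖P₁‖ ≤ k) (hP₂ : ‖P₂‖ ≤ k) (hA₂ : ‖A₂‖ ≤ a) (hG₁ : ‖G₁‖ ≤ g) (hG₂ : ‖G₂‖ ≤ g) :
    ‖riccatiField A₁ G₁ H₁ P₁ - riccatiField A₂ G₂ H₂ P₂‖ ≤
      (2 * a + 2 * (k * g)) * ‖P₁ - P₂‖ +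
        (2 * (k * ‖A₁ - A₂‖) + k ^ 2 * ‖G₁ - G₂‖ + ‖H₁ - H₂‖) := by
  have hk : 0 ≤ k := (norm_nonneg _).trans hP₁
  have ha : 0 ≤ a := (norm_nonneg _).trans hA₂
  have hg : 0 ≤ g := (norm_nonneg _).trans hG₁
  have e1 : ‖(A₁ - A₂) * P₁‖ ≤ ‖A₁ - A₂‖ * k := (norm_mul_le _ _).trans (by gcongr)
  have e2 : ‖A₂ * (P₁ - P₂)‖ ≤ a * ‖P₁ - P₂‖ := (norm_mul_le _ _).trans (by gcongr)
  have e3 : ‖P₁ * (A₁ - A₂)ᵀ‖ ≤ k * ‖A₁ - A₂‖ :=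
    (norm_mul_le _ _).trans (by rw [norm_transpose_eq]; gcongr)
  have e4 : ‖(P₁ - P₂) * A₂ᵀ‖ ≤ ‖P₁ - P₂‖ * a :=
    (norm_mul_le _ _).trans (by rw [norm_transpose_eq]; gcongr)
  have e5 : ‖(P₁ - P₂) * G₁ * P₁‖ ≤ ‖P₁ - P₂‖ * g * k :=
    norm_mul₃_le.trans (by gcongr)
  have e6 : ‖P₂ * (G₁ - G₂) * P₁‖ ≤ k * ‖G₁ - G₂‖ * k := norm_mul₃_le.trans (by gcongr)
  have e7 : ‖P₂ * G₂ * (P₁ - P₂)‖ ≤ k * g * ‖P₁ - P₂‖ := norm_mul₃_le.trans (by gcongr)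
  rw [riccatiField_sub]
  refine (norm_add_le_of_le (norm_sub_le_of_le (norm_sub_le_of_le (norm_sub_le_of_le
    (norm_add_le_of_le (norm_add_le_of_le (norm_add_le_of_le e1 e2) e3) e4) e5) e6) e7)
    le_rfl).trans (le_of_eq ?_)
  ring

namespace IsRiccatiCurve

variable {T : ℝ} {A G H : Matrix (Fin n) (Fin n) ℝ} {P : ℝ → Matrix (Fin n) (Fin n) ℝ}

/-- Grönwall needs a right derivative at `0` too, where the equation is not assumed; it is the limit
of the derivatives from the right. -/
lemma hasDerivWithinAt_Ici (hP : IsRiccatiCurve T A G H P) {t : ℝ} (ht : t ∈ Ico 0 T) :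
    HasDerivWithinAt P (riccatiField A G H (P t)) (Ici t) t := by
  have hsub : Ioo t T ⊆ Ioo 0 T := Ioo_subset_Ioo_left ht.1
  have hmem : Ioo t T ∈ 𝓝[>] t := Ioo_mem_nhdsGT ht.2
  have hcont : ContinuousWithinAt P (Ioo t T) t :=
    (hP.continuousOn t ⟨ht.1, ht.2.le⟩).mono (hsub.trans Ioo_subset_Icc_self)
  refine hasDerivWithinAt_Ici_of_tendsto_deriv
    (fun s hs => (hP.hasDerivAt s (hsub hs)).differentiableAt.differentiableWithinAt)
    hcont hmem ?_
  have hlim : Tendsto P (𝓝[>] t) (𝓝 (P t)) := by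
    rw [← nhdsWithin_Ioo_eq_nhdsGT ht.2]
    exact hcont
  refine (((continuous_riccatiField A G H).tendsto _).comp hlim).congr' ?_
  filter_upwards [hmem] with s hs
  exact (hP.hasDerivAt s (hsub hs)).deriv.symm

lemma norm_sub_le {A₁ A₂ G₁ G₂ H₁ H₂ : Matrix (Fin n) (Fin n) ℝ}
    {P₁ P₂ : ℝ → Matrix (Fin n) (Fin n) ℝ} (h₁ : IsRiccatiCurve T A₁ G₁ H₁ P₁)
    (h₂ : IsRiccatiCurve T A₂ G₂ H₂ P₂) {k a g : ℝ}
    (hP₁ : ∀ t ∈ Icc 0 T, ‖P₁ t‖ ≤ k) (hP₂ : ∀ t ∈ Icc 0 T, ‖P₂ t‖ ≤ k)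
    (hA₂ : ‖A₂‖ ≤ a) (hG₁ : ‖G₁‖ ≤ g) (hG₂ : ‖G₂‖ ≤ g) {t : ℝ} (ht : t ∈ Icc 0 T) :
    ‖P₁ t - P₂ t‖ ≤ gronwallBound ‖P₁ 0 - P₂ 0‖ (2 * a + 2 * (k * g))
      (2 * (k * ‖A₁ - A₂‖) + k ^ 2 * ‖G₁ - G₂‖ + ‖H₁ - H₂‖) t := by
  simpa using norm_le_gronwallBound_of_norm_deriv_right_le (h₁.continuousOn.sub h₂.continuousOn)
    (fun s hs => (h₁.hasDerivWithinAt_Ici hs).sub (h₂.hasDerivWithinAt_Ici hs)) le_rfl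
    (fun s hs => norm_riccatiField_sub_le (hP₁ s ⟨hs.1, hs.2.le⟩) (hP₂ s ⟨hs.1, hs.2.le⟩)
      hA₂ hG₁ hG₂) t ht

lemma transpose (hP : IsRiccatiCurve T A G H P) (hG : Gᵀ = G) (hH : Hᵀ = H) :
    IsRiccatiCurve T A G H fun t => (P t)ᵀ where
  continuousOn := continuous_id.matrix_transpose.comp_continuousOn hP.continuousOn
  hasDerivAt t ht := by
    let L : Matrix (Fin n) (Fin n) ℝ →L[ℝ] Matrix (Fin n) (Fin n) ℝ :=
      LinearMap.toContinuousLinearMap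
        (Matrix.transposeLinearEquiv (Fin n) (Fin n) ℝ ℝ).toLinearMap
    have h : HasDerivAt (fun t => (P t)ᵀ) (riccatiField A G H (P t))ᵀ t :=
      L.hasFDerivAt.comp_hasDerivAt t (hP.hasDerivAt t ht)
    convert h using 1
    simp only [riccatiField, Matrix.transpose_add, Matrix.transpose_sub, Matrix.transpose_mul,
      Matrix.transpose_transpose, hG, hH, Matrix.mul_assoc]
    abel

/-- Solutions with symmetric data are symmetric, by uniqueness. -/
lemma transpose_eq (hP : IsRiccatiCurve T A G H P) (hG : Gᵀ = G) (hH : Hᵀ = H)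
    (h0 : (P 0)ᵀ = P 0) {t : ℝ} (ht : t ∈ Icc 0 T) : (P t)ᵀ = P t := by
  -- A bound depending on `P` suffices here: with equal data and initial values the Grönwall bound
  -- is zero.
  obtain ⟨k, hk⟩ := isCompact_Icc.exists_bound_of_continuousOn hP.continuousOn
  have h := norm_sub_le (hP.transpose hG hH) hP
    (fun s hs => (norm_transpose_eq (P s)).trans_le (hk s hs)) hk le_rfl le_rfl le_rfl ht
  simp only [h0, sub_self, norm_zero, mul_zero, add_zero, gronwallBound_ε0_δ0] at h
  exact sub_eq_zero.1 (norm_le_zero_iff.1 h)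

end IsRiccatiCurve

lemma quadraticForm_riccatiField_of_mulVec_eq {A G H P : Matrix (Fin n) (Fin n) ℝ} {x : Fin n → ℝ}
    {ν : ℝ} (hP : Pᵀ = P) (hx : P *ᵥ x = ν • x) :
    x ⬝ᵥ riccatiField A G H P *ᵥ x =
      2 * ν * (x ⬝ᵥ A *ᵥ x) - ν ^ 2 * (x ⬝ᵥ G *ᵥ x) + x ⬝ᵥ H *ᵥ x := by
  have hx' : x ᵥ* P = ν • x := by rw [← Matrix.mulVec_transpose, hP, hx]
  have hA : x ⬝ᵥ Aᵀ *ᵥ x = x ⬝ᵥ A *ᵥ x := by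
    rw [Matrix.mulVec_transpose, dotProduct_comm, Matrix.dotProduct_mulVec]
  have hleft : ∀ y, x ⬝ᵥ P *ᵥ y = ν * (x ⬝ᵥ y) := fun y => by
    rw [Matrix.dotProduct_mulVec, hx', smul_dotProduct, smul_eq_mul]
  simp only [riccatiField, Matrix.add_mulVec, Matrix.sub_mulVec, dotProduct_add, dotProduct_sub,
    ← Matrix.mulVec_mulVec, hx, hleft, hA, Matrix.mulVec_smul, dotProduct_smul, smul_eq_mul]
  ring

lemma hasDerivAt_smul_exp_smul_one (c k t : ℝ) :
    HasDerivAt (fun s => (c * Real.exp (k * s)) • (1 : Matrix (Fin n) (Fin n) ℝ))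
      ((k * (c * Real.exp (k * t))) • (1 : Matrix (Fin n) (Fin n) ℝ)) t := by
  have h : HasDerivAt (fun s => c * Real.exp (k * s)) (k * (c * Real.exp (k * t))) t := by
    convert! (((hasDerivAt_id t).const_mul k).exp).const_mul c using 1
    simp; ring
  exact h.smul_const _

namespace IsRiccatiCurve

variable {T : ℝ} {A G H : Matrix (Fin n) (Fin n) ℝ} {P : ℝ → Matrix (Fin n) (Fin n) ℝ}

/-- A lower barrier for the quadratic form of a Riccati solution. -/
lemma neg_le_quadraticForm (hP : IsRiccatiCurve T A G H P)
    (hsymm : ∀ t ∈ Icc 0 T, (P t)ᵀ = P t) (h0 : (P 0).PosSemidef) (hH : H.PosSemidef)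
    {a g k : ℝ} (hA : ‖A‖ ≤ a) (hG : ‖G‖ ≤ g) (hk : 2 * a + g < k) {t : ℝ} (ht : t ∈ Ico 0 T)
    {x : Fin n → ℝ} (hx : x ⬝ᵥ x = 1) : -1 ≤ x ⬝ᵥ P t *ᵥ x := by
  have ha : 0 ≤ a := (norm_nonneg _).trans hA
  have hg : 0 ≤ g := (norm_nonneg _).trans hG
  have hkpos : 0 < k := by linarith
  -- This normalization keeps the barrier `μ = c * exp (k * s)` at most `1` on `[0,T]`, so the
  -- quadratic term `μ² g` is absorbed by `μ g` and `k > 2a + g` wins.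
  set c := Real.exp (-(k * T)) with hc
  have hμ : ∀ s ≤ T, c * Real.exp (k * s) ≤ 1 := fun s hs => by
    rw [hc, ← Real.exp_add, Real.exp_le_one_iff]
    nlinarith
  have key := quadraticForm_pos_of_deriv_pos_on_ker
    (W := fun s => P s + (c * Real.exp (k * s)) • (1 : Matrix (Fin n) (Fin n) ℝ))
    (hP.continuousOn.add
      (by fun_prop : Continuous fun s : ℝ => (c * Real.exp (k * s)) •
        (1 : Matrix (Fin n) (Fin n) ℝ)).continuousOn)
    (fun s hs => by simp [hsymm s hs])
    (fun y hy => by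
      have := h0.dotProduct_mulVec_nonneg y
      rw [star_trivial] at this
      simp only [Matrix.add_mulVec, Matrix.smul_mulVec, Matrix.one_mulVec, dotProduct_add,
        dotProduct_smul, hy, smul_eq_mul]
      positivity)
    (fun s hs => (hP.hasDerivAt s hs).add (hasDerivAt_smul_exp_smul_one c k s))
    (fun s hs y hy hker => by
      have hs' : s ∈ Icc 0 T := Ioo_subset_Icc_self hs
      have hμ1 := hμ s hs'.2
      have hμ0 : 0 < c * Real.exp (k * s) := by positivity
      set μ := c * Real.exp (k * s)
      have hPy : P s *ᵥ y = (-μ) • y := by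
        rw [Matrix.add_mulVec, Matrix.smul_mulVec, Matrix.one_mulVec] at hker
        rw [neg_smul]
        exact eq_neg_of_add_eq_zero_left hker
      have hAy := abs_le.1 (abs_quadraticForm_le A y)
      have hGy := abs_le.1 (abs_quadraticForm_le G y)
      have hHy := hH.dotProduct_mulVec_nonneg y
      rw [star_trivial] at hHy
      rw [hy, mul_one] at hAy hGy
      rw [Matrix.add_mulVec, dotProduct_add, quadraticForm_riccatiField_of_mulVec_eq (hsymm s hs')
        hPy, Matrix.smul_mulVec, Matrix.one_mulVec, dotProduct_smul, hy, smul_eq_mul, mul_one]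
      have h1 : μ * (μ * (y ⬝ᵥ G *ᵥ y)) ≤ μ * g :=
        mul_le_mul_of_nonneg_left (by nlinarith [hGy.2]) hμ0.le
      have h2 : μ * (y ⬝ᵥ A *ᵥ y) ≤ μ * a := by gcongr; linarith [hAy.2]
      nlinarith [mul_lt_mul_of_pos_left hk hμ0])
  have h := key t ht x hx
  simp only [Matrix.add_mulVec, Matrix.smul_mulVec, Matrix.one_mulVec, dotProduct_add,
    dotProduct_smul, hx, smul_eq_mul, mul_one] at h
  linarith [hμ t ht.2.le]

/-- An upper barrier for the quadratic form of a Riccati solution. -/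
lemma quadraticForm_le (hP : IsRiccatiCurve T A G H P)
    (hsymm : ∀ t ∈ Icc 0 T, (P t)ᵀ = P t) (hGpos : G.PosSemidef)
    {a b c k : ℝ} (hA : ‖A‖ ≤ a) (hH : ‖H‖ ≤ b) (hc : 1 ≤ c) (h0 : ‖P 0‖ < c)
    (hk : 2 * a + b < k) {t : ℝ} (ht : t ∈ Ico 0 T)
    {x : Fin n → ℝ} (hx : x ⬝ᵥ x = 1) : x ⬝ᵥ P t *ᵥ x ≤ c * Real.exp (k * t) := by
  have ha : 0 ≤ a := (norm_nonneg _).trans hA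
  have hb : 0 ≤ b := (norm_nonneg _).trans hH
  have hkpos : 0 < k := by linarith
  have key := quadraticForm_pos_of_deriv_pos_on_ker
    (W := fun s => (c * Real.exp (k * s)) • (1 : Matrix (Fin n) (Fin n) ℝ) - P s)
    ((by fun_prop : Continuous fun s : ℝ => (c * Real.exp (k * s)) •
        (1 : Matrix (Fin n) (Fin n) ℝ)).continuousOn.sub hP.continuousOn)
    (fun s hs => by simp [hsymm s hs])
    (fun y hy => by
      have := (abs_le.1 (abs_quadraticForm_le (P 0) y)).2
      rw [hy] at this
      simp only [Matrix.sub_mulVec, Matrix.smul_mulVec, Matrix.one_mulVec, dotProduct_sub,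
        dotProduct_smul, hy, smul_eq_mul, mul_zero, Real.exp_zero, mul_one] at this ⊢
      linarith)
    (fun s hs => (hasDerivAt_smul_exp_smul_one c k s).sub (hP.hasDerivAt s hs))
    (fun s hs y hy hker => by
      have hs' : s ∈ Icc 0 T := Ioo_subset_Icc_self hs
      -- With `μ ≥ 1` the inhomogeneity `b` is absorbed by `μ b`; the quadratic term has a
      -- favourable sign.
      have hμ1 : 1 ≤ c * Real.exp (k * s) :=
        one_le_mul_of_one_le_of_one_le hc (Real.one_le_exp (mul_nonneg hkpos.le hs'.1))
      set μ := c * Real.exp (k * s)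
      have hPy : P s *ᵥ y = μ • y := by
        rw [Matrix.sub_mulVec, Matrix.smul_mulVec, Matrix.one_mulVec] at hker
        exact (sub_eq_zero.1 hker).symm
      have hAy := abs_le.1 (abs_quadraticForm_le A y)
      have hHy := abs_le.1 (abs_quadraticForm_le H y)
      have hGy := hGpos.dotProduct_mulVec_nonneg y
      rw [star_trivial] at hGy
      rw [hy, mul_one] at hAy hHy
      rw [Matrix.sub_mulVec, dotProduct_sub, quadraticForm_riccatiField_of_mulVec_eq (hsymm s hs')
        hPy, Matrix.smul_mulVec, Matrix.one_mulVec, dotProduct_smul, hy, smul_eq_mul, mul_one]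
      have h1 : 0 ≤ μ ^ 2 * (y ⬝ᵥ G *ᵥ y) := by positivity
      have h2 : μ * (y ⬝ᵥ A *ᵥ y) ≤ μ * a := by gcongr; linarith [hAy.2]
      have h3 : b ≤ μ * b := le_mul_of_one_le_left hb hμ1
      nlinarith [mul_lt_mul_of_pos_left hk (zero_lt_one.trans_le hμ1)])
  have h := key t ht x hx
  simp only [Matrix.sub_mulVec, Matrix.smul_mulVec, Matrix.one_mulVec, dotProduct_sub,
    dotProduct_smul, hx, smul_eq_mul, mul_one] at h
  linarith

/-- A bound for Riccati solutions with positive semidefinite data that does not depend on the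
dimension. -/
lemma norm_le (hT : 0 < T) (hP : IsRiccatiCurve T A G H P) (h0 : (P 0).PosSemidef)
    (hGpos : G.PosSemidef) (hHpos : H.PosSemidef) {a b c k : ℝ} (hA : ‖A‖ ≤ a) (hG : ‖G‖ ≤ b)
    (hH : ‖H‖ ≤ b) (hc : 1 ≤ c) (hc0 : ‖P 0‖ < c) (hk : 2 * a + b < k) {t : ℝ}
    (ht : t ∈ Icc 0 T) : ‖P t‖ ≤ c * Real.exp (k * T) := by
  have htr : ∀ {S : Matrix (Fin n) (Fin n) ℝ}, S.PosSemidef → Sᵀ = S := fun {S} hS => by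
    rw [← Matrix.conjTranspose_eq_transpose_of_trivial]; exact hS.isHermitian
  have hsymm : ∀ s ∈ Icc 0 T, (P s)ᵀ = P s := fun s hs =>
    hP.transpose_eq (htr hGpos) (htr hHpos) (htr h0) hs
  have ha : 0 ≤ a := (norm_nonneg _).trans hA
  have hb : 0 ≤ b := (norm_nonneg _).trans hG
  have hkpos : 0 < k := by linarith
  have hK : 1 ≤ c * Real.exp (k * T) :=
    one_le_mul_of_one_le_of_one_le hc (Real.one_le_exp (by positivity))
  have hIco : ∀ s ∈ Ico 0 T, ‖P s‖ ≤ c * Real.exp (k * T) := by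
    intro s hs
    refine norm_le_of_abs_quadraticForm_le (hsymm s ⟨hs.1, hs.2.le⟩) (by linarith) fun x => ?_
    refine abs_quadraticForm_le_of_unit (fun y hy => abs_le.2 ⟨?_, ?_⟩) x
    · linarith [hP.neg_le_quadraticForm hsymm h0 hHpos hA hG hk hs hy]
    · refine (hP.quadraticForm_le hsymm hGpos hA hH hc hc0 hk hs hy).trans ?_
      gcongr
      exact hs.2.le
  -- The barriers hold only before `T`; continuity adds the endpoint.
  have hclosure : closure (Ico 0 T) = Icc 0 T := closure_Ico hT.ne
  have := hP.continuousOn.norm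
  rw [← hclosure] at this ht
  exact le_on_closure hIco this continuousOn_const ht

end IsRiccatiCurve

end RiccatiCurve

/-! ### Dependence on the data tuple -/

/-- `gronwallBound` is monotone and jointly homogeneous in `δ` and `ε`, so the size `s` of the
perturbation factors out. -/
lemma gronwallBound_le_mul {δ L ε s e t T : ℝ} (hL : 0 < L) (hδ : δ ≤ s) (hs : 0 ≤ s)
    (hε : ε ≤ e * s) (he : 0 ≤ e) (ht : t ∈ Icc 0 T) :
    gronwallBound δ L ε t ≤ gronwallBound 1 L e T * s := by
  have hexp : 0 ≤ Real.exp (L * t) - 1 :=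
    sub_nonneg.2 (Real.one_le_exp (mul_nonneg hL.le ht.1))
  calc gronwallBound δ L ε t ≤ gronwallBound s L (e * s) t := by
        simp only [gronwallBound_of_K_ne_0 hL.ne']
        gcongr
    _ ≤ gronwallBound s L (e * s) T := gronwallBound_mono hs (mul_nonneg he hs) hL.le ht.2
    _ = gronwallBound 1 L e T * s := by
        simp only [gronwallBound_of_K_ne_0 hL.ne']
        ring

lemma norm_mul_mul_le_of_le {n m r l : ℕ} {X : Matrix (Fin n) (Fin m) ℝ}
    {Y : Matrix (Fin m) (Fin r) ℝ} {Z : Matrix (Fin r) (Fin l) ℝ} {a b c : ℝ}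
    (hX : ‖X‖ ≤ a) (hY : ‖Y‖ ≤ b) (hZ : ‖Z‖ ≤ c) : ‖X * Y * Z‖ ≤ a * b * c := by
  have ha := (norm_nonneg _).trans hX
  have hb := (norm_nonneg _).trans hY
  calc ‖X * Y * Z‖ ≤ ‖X * Y‖ * ‖Z‖ := Matrix.l2_opNorm_mul _ _
    _ ≤ ‖X‖ * ‖Y‖ * ‖Z‖ := by gcongr; exact Matrix.l2_opNorm_mul _ _
    _ ≤ a * b * c := by gcongr

/-- Resolvent identity `Q₁⁻¹ - Q₂⁻¹ = Q₁⁻¹ (Q₂ - Q₁) Q₂⁻¹`. -/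
lemma norm_inv_sub_inv_le {r : ℕ} {Q₁ Q₂ : Matrix (Fin r) (Fin r) ℝ} (h₁ : IsUnit Q₁)
    (h₂ : IsUnit Q₂) {c : ℝ} (hc₁ : ‖Q₁⁻¹‖ ≤ c) (hc₂ : ‖Q₂⁻¹‖ ≤ c) :
    ‖Q₁⁻¹ - Q₂⁻¹‖ ≤ c * ‖Q₁ - Q₂‖ * c := by
  rw [Matrix.inv_sub_inv (iff_of_true h₁ h₂), norm_sub_rev Q₁ Q₂]
  exact norm_mul_mul_le_of_le hc₁ le_rfl hc₂

section Data

variable {n m r : ℕ}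

lemma Data.norm₁_sub (S S' : Data n m r) :
    (S - S').norm₁ = ‖S.A - S'.A‖ + ‖S.Γ - S'.Γ‖ + ‖S.R - S'.R‖ + ‖S.Q - S'.Q‖ := rfl

/-- The coefficient `Cᵀ Q⁻¹ C` of the quadratic term of the filter Riccati equation. -/
noncomputable def Data.gain (S : Data n m r) (C : Matrix (Fin r) (Fin n) ℝ) :
    Matrix (Fin n) (Fin n) ℝ :=
  Cᵀ * S.Q⁻¹ * C

variable {T : ℝ} {hT : 0 < T} {B : Matrix (Fin n) (Fin m) ℝ} {C : Matrix (Fin r) (Fin n) ℝ}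
  {S : Data n m r} {P : C(Icc (0 : ℝ) T, Matrix (Fin n) (Fin n) ℝ)}

lemma IsRiccatiSolution.apply_zero (hP : IsRiccatiSolution hT B C S P) :
    IccExtend hT.le P 0 = S.Γ := by
  rw [IccExtend_of_mem hT.le P (left_mem_Icc.2 hT.le)]
  exact hP.1

lemma IsRiccatiSolution.isRiccatiCurve (hP : IsRiccatiSolution hT B C S P) :
    IsRiccatiCurve T S.A (S.gain C) (B * S.R * Bᵀ) (IccExtend hT.le P) where
  continuousOn := (P.continuous.Icc_extend' (h := hT.le)).continuousOn
  hasDerivAt t ht := by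
    have ht' : t ∈ Icc 0 T := Ioo_subset_Icc_self ht
    have h := hP.2 ⟨t, ht'⟩ ht
    rw [IccExtend_of_mem hT.le P ht']
    simpa only [riccatiField, Data.gain, Matrix.mul_assoc] using h

lemma Data.IsAdmissible.posSemidef_gain (hS : S.IsAdmissible) : (S.gain C).PosSemidef := by
  rw [Data.gain, ← Matrix.conjTranspose_eq_transpose_of_trivial]
  exact hS.2.2.inv.posSemidef.conjTranspose_mul_mul_same C

lemma Data.IsAdmissible.posSemidef_noise (hS : S.IsAdmissible) :
    (B * S.R * Bᵀ).PosSemidef := by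
  rw [← Matrix.conjTranspose_eq_transpose_of_trivial]
  exact hS.2.1.posSemidef.mul_mul_conjTranspose_same B

lemma norm_gain_le {N : ℝ} (hC : ‖C‖ ≤ N) (hQ : ‖S.Q⁻¹‖ ≤ N) : ‖S.gain C‖ ≤ N * N * N :=
  norm_mul_mul_le_of_le ((norm_transpose_eq C).trans_le hC) hQ hC

lemma norm_noise_le {N : ℝ} (hB : ‖B‖ ≤ N) (hR : ‖S.R‖ ≤ N) : ‖B * S.R * Bᵀ‖ ≤ N * N * N :=
  norm_mul_mul_le_of_le hB hR ((norm_transpose_eq B).trans_le hB)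

lemma IsRiccatiSolution.norm_le {N : ℝ} (hN : 0 ≤ N) (hS : S.IsAdmissible) (hB : ‖B‖ ≤ N)
    (hC : ‖C‖ ≤ N) (hnorm : S.norm₁ ≤ N) (hQ : ‖S.Q⁻¹‖ ≤ N) (hP : IsRiccatiSolution hT B C S P)
    {t : ℝ} (ht : t ∈ Icc 0 T) :
    ‖IccExtend hT.le P t‖ ≤ (N + 1) * Real.exp ((2 * N + N * N * N + 1) * T) := by
  have hA := norm_nonneg S.A
  have hΓ := norm_nonneg S.Γ
  have hR := norm_nonneg S.R
  have hQ' := norm_nonneg S.Q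
  rw [Data.norm₁] at hnorm
  -- The barrier constants are `c = N + 1` and `k = 2a + b + 1`; each `+ 1` provides a strict
  -- inequality.
  refine hP.isRiccatiCurve.norm_le hT ?_ hS.posSemidef_gain hS.posSemidef_noise
    (a := N) (b := N * N * N) (by linarith) (norm_gain_le hC hQ)
    (norm_noise_le hB (by linarith)) (by linarith) ?_ (by linarith) ht
  · rw [hP.apply_zero]
    exact hS.1.posSemidef
  · rw [hP.apply_zero]
    linarith

end Data

end KalmanRiccati

open KalmanRiccati in
theorem mainTheorem6 (T : ℝ) (hT : 0 < T) (M : ℝ) :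
    ∃ cPi : ℝ, 0 < cPi ∧
      ∀ (n m r : ℕ) (B : Matrix (Fin n) (Fin m) ℝ) (C : Matrix (Fin r) (Fin n) ℝ)
        (Sstar Sbar : KalmanRiccati.Data n m r),
        Sstar.IsAdmissible → Sbar.IsAdmissible →
        ‖B‖ ≤ M → ‖C‖ ≤ M →
        Sstar.norm₁ ≤ M → Sbar.norm₁ ≤ M →
        ‖Sstar.Q⁻¹‖ ≤ M → ‖Sbar.Q⁻¹‖ ≤ M →
        ∀ Pstar Pbar : C(Set.Icc (0 : ℝ) T, Matrix (Fin n) (Fin n) ℝ),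
          KalmanRiccati.IsRiccatiSolution hT B C Sstar Pstar →
          KalmanRiccati.IsRiccatiSolution hT B C Sbar Pbar →
          ‖Pstar - Pbar‖ ≤ cPi * (Sstar - Sbar).norm₁ := by
  -- Enlarging `M` makes the Grönwall exponent positive.
  set N := |M| + 1 with hN
  have hN0 : 0 < N := by positivity
  have hMN : M ≤ N := by linarith [le_abs_self M]
  set k := (N + 1) * Real.exp ((2 * N + N * N * N + 1) * T) with hk
  have hk0 : 0 < k := by positivity
  set L := 2 * N + 2 * (k * (N * N * N)) with hL
  have hL0 : 0 < L := by positivity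
  -- The three terms are the Lipschitz contributions of `A`, of `Q` (two factors `N` from `C`, two
  -- from the inverses) and of `R`.
  set e := 2 * k + k ^ 2 * (N * N * N * N) + N * N with he
  have he0 : 0 ≤ e := by positivity
  have hpos : 0 < gronwallBound 1 L e T := by
    have h := gronwallBound_mono zero_le_one he0 hL0.le hT.le
    rw [gronwallBound_x0] at h
    linarith
  refine ⟨gronwallBound 1 L e T, hpos, ?_⟩
  intro n m r B C S S' hS hS' hB hC hnS hnS' hQ hQ' P P' hP hP'
  have hB := hB.trans hMN
  have hC := hC.trans hMN
  have hnS := hnS.trans hMN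
  have hnS' := hnS'.trans hMN
  have hQ := hQ.trans hMN
  have hQ' := hQ'.trans hMN
  have hA0 := norm_nonneg (S.A - S'.A)
  have hΓ0 := norm_nonneg (S.Γ - S'.Γ)
  have hR0 := norm_nonneg (S.R - S'.R)
  have hQ0 := norm_nonneg (S.Q - S'.Q)
  have hs0 : 0 ≤ (S - S').norm₁ := by rw [Data.norm₁_sub]; positivity
  have hA' : ‖S'.A‖ ≤ N := by
    have := norm_nonneg S'.Γ
    have := norm_nonneg S'.R
    have := norm_nonneg S'.Q
    rw [Data.norm₁] at hnS'
    linarith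
  have hG : ‖S.gain C - S'.gain C‖ ≤ N * (N * ‖S.Q - S'.Q‖ * N) * N := by
    rw [Data.gain, Data.gain, ← Matrix.sub_mul, ← Matrix.mul_sub]
    exact norm_mul_mul_le_of_le ((norm_transpose_eq C).trans_le hC)
      (norm_inv_sub_inv_le hS.2.2.isUnit hS'.2.2.isUnit hQ hQ') hC
  have hH : ‖B * S.R * Bᵀ - B * S'.R * Bᵀ‖ ≤ N * ‖S.R - S'.R‖ * N := by
    rw [← Matrix.sub_mul, ← Matrix.mul_sub]
    exact norm_mul_mul_le_of_le hB le_rfl ((norm_transpose_eq B).trans_le hB)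
  have hε : 2 * (k * ‖S.A - S'.A‖) + k ^ 2 * ‖S.gain C - S'.gain C‖
      + ‖B * S.R * Bᵀ - B * S'.R * Bᵀ‖ ≤ e * (S - S').norm₁ := by
    calc _ ≤ 2 * (k * (S - S').norm₁) + k ^ 2 * (N * (N * (S - S').norm₁ * N) * N)
          + N * (S - S').norm₁ * N := by
          refine add_le_add (add_le_add ?_ ?_) (hH.trans ?_)
          · gcongr; rw [Data.norm₁_sub]; linarith
          · gcongr; refine hG.trans ?_; gcongr; rw [Data.norm₁_sub]; linarith
          · gcongr; rw [Data.norm₁_sub]; linarith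
      _ = _ := by rw [he]; ring
  refine (ContinuousMap.norm_le _ (mul_nonneg hpos.le hs0)).2 fun t => ?_
  have hdiff := hP.isRiccatiCurve.norm_sub_le hP'.isRiccatiCurve
    (fun s hs => hP.norm_le hN0.le hS hB hC hnS hQ hs)
    (fun s hs => hP'.norm_le hN0.le hS' hB hC hnS' hQ' hs)
    hA' (norm_gain_le hC hQ) (norm_gain_le hC hQ') t.2
  rw [hP.apply_zero, hP'.apply_zero, Set.IccExtend_val, Set.IccExtend_val] at hdiff
  exact hdiff.trans (gronwallBound_le_mul hL0 (by rw [Data.norm₁_sub]; linarith) hs0 hε he0 t.2)
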